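/- Let $n\ge 2$ and let $\Phi:\mathbb{R}\to\mathbb{R}$ be a real analytic function which is bounded below and satisfies $\lim_{y\to+\infty}\Phi(y)=+\infty$. Put $\phi=\Phi'$ and assume that $\phi'(y)\neq 0$ for all $y\in\mathbb{R}$. Consider the double-forced multiparticle system with state $x=(q,p)=(q_1,\dots,q_n,p_1,\dots,p_n)\in\mathbb{R}^{2n}$ and control $(u,v)\in\mathbb{R}^2$, $$\dot q_k=p_k\ (1\le k\le n),\qquad \dot p_k=\phi(q_{k-1}-q_k)-\phi(q_k-q_{k+1})\ (2\le k\le n-1),$$ $$\dot p_1=-\phi(q_1-q_2)+u,\qquad \dot p_n=\phi(q_{n-1}-q_n)+v.$$ This system is of constant rank. That is, for every $x^0\in\mathbb{R}^{2n}$ and every $T>0$: for each control $(u,v)\in L^\infty([0,T];\mathbb{R}^2)$ the trajectory with $x(0)=x^0$ driven by $(u,v)$ exists on all of $[0,T]$ and its end-point $x(T)$ is unique, so that the input/end-point map $\mathcal{E}_{x^0,T}:L^\infty([0,T];\mathbb{R}^2)\to\mathbb{R}^{2n}$, $(u,v)\mapsto x(T)$, is well defined; this map is Fréchet differentiable; and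 the rank of its differential at $(u,v)$ does not depend on $(u,v)$. -/

import Mathlib

open MeasureTheory Set

/-! ## Control systems and their input/end-point maps -/

/-- The admissible inputs on `[0, T]`: essentially bounded measurable controls
with values in `U`, i.e. the Banach space `L^∞([0, T]; U)`. -/
abbrev ControlSpace (U : Type*) [NormedAddCommGroup U] (T : ℝ) : Type _ :=
  Lp U ⊤ (volume.restrict (Icc (0 : ℝ) T))

/-- `x` is, on `[0, T]`, the (Carathéodory) trajectory of the control system `x' = f(x, u)` which
starts at `x₀` at time `0` and is driven by the control `u`: it is the continuous function with
`x(t) = x₀ + ∫₀ᵗ f(x(s), u(s)) ds`. -/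
structure IsTrajectory {X U : Type*} [NormedAddCommGroup X] [NormedSpace ℝ X]
    (f : X → U → X) (T : ℝ) (x₀ : X) (u : ℝ → U) (x : ℝ → X) : Prop where
  continuousOn : ContinuousOn x (Icc 0 T)
  integrable : IntervalIntegrable (fun s => f (x s) (u s)) volume 0 T
  eq_integral : ∀ t ∈ Icc (0 : ℝ) T, x t = x₀ + ∫ s in (0 : ℝ)..t, f (x s) (u s)

/-- `E` is the input/end-point map of the system `x' = f(x, u)` with parameters `x₀, T`: for each
admissible control `u`, trajectories from `x₀` driven by `u` exist on the whole of `[0, T]`, and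
they all end, at time `T`, at the point `E u`. There is at most one such `E`. -/
def IsEndpointMap {X U : Type*} [NormedAddCommGroup X] [NormedSpace ℝ X]
    [NormedAddCommGroup U] (f : X → U → X) (x₀ : X) (T : ℝ) (E : ControlSpace U T → X) : Prop :=
  ∀ (u : ControlSpace U T) (y : X),
    (∃ x : ℝ → X, IsTrajectory f T x₀ u x ∧ x T = y) ↔ y = E u

/-- The control system `x' = f(x, u)` is of constant rank: for all `x₀` and `T > 0`, the
input/end-point map is well defined on all admissible controls, it is (Fréchet) differentiable
there, and the rank of its differential at `u` does not depend on `u`. -/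
def IsOfConstantRank {X U : Type*} [NormedAddCommGroup X] [NormedSpace ℝ X]
    [NormedAddCommGroup U] [NormedSpace ℝ U] (f : X → U → X) : Prop :=
  ∀ (x₀ : X) (T : ℝ), 0 < T →
    ∃ E : ControlSpace U T → X, IsEndpointMap f x₀ T E ∧ Differentiable ℝ E ∧
      ∀ u₁ u₂ : ControlSpace U T,
        (fderiv ℝ E u₁).toLinearMap.rank = (fderiv ℝ E u₂).toLinearMap.rank

/-! ## The double-forced multiparticle system -/

/-- The interaction force on the `k`-th of `n` particles on a line,
`φ(q_{k-1} - q_k) - φ(q_k - q_{k+1})`, where the first term is absent for the first particle and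
the second one is absent for the last particle. Particles are numbered from `0` to `n - 1`. -/
noncomputable def interactionForce {n : ℕ} (φ : ℝ → ℝ) (q : Fin n → ℝ) (k : Fin n) : ℝ :=
  (if 0 < (k : ℕ) then φ (q ⟨(k : ℕ) - 1, lt_of_le_of_lt (Nat.sub_le _ _) k.isLt⟩ - q k)
    else 0) -
  (if h : (k : ℕ) + 1 < n then φ (q k - q ⟨(k : ℕ) + 1, h⟩) else 0)

/-- The right-hand side of the double-forced multiparticle system with interaction potential `Φ`:
the state is `(q, p)`, the control is `(u, v)`, the force is `φ = Φ'`, and `q_k' = p_k`, while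
`p_k'` is the interaction force, to which `u` is added for the first particle and `v` for the
last one. -/
noncomputable def doubleForcedField (n : ℕ) (Φ : ℝ → ℝ)
    (x : (Fin n → ℝ) × (Fin n → ℝ)) (w : ℝ × ℝ) : (Fin n → ℝ) × (Fin n → ℝ) :=
  (x.2, fun k => interactionForce (deriv Φ) x.1 k
    + (if (k : ℕ) = 0 then w.1 else 0) + (if (k : ℕ) + 1 = n then w.2 else 0))

/-!
The system has the form `x' = F(x) + B w` with `F` smooth and `B` linear, and its end-point map is
in fact a submersion for every control, so that its rank is always the dimension `2n` of the state
space.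

*The end-point map is well defined.* Subtracting the integrated input `∫ B w` from a trajectory
leaves a classical solution of an equation whose right-hand side is continuous in time and locally
Lipschitz (`IsTrajectory.hasDerivWithinAt`). Only the power `p₁ u + pₙ v` of the external forces
changes the energy of the chain. As the potential is bounded below, the energy dominates the square
of the largest momentum, and it grows at most linearly with that momentum; thus trajectories are
bounded a priori (`hasAprioriBounds_chain`), which yields global existence
(`exists_solution_of_apriori_bound`).

*It is differentiable.* Let `p` solve the adjoint equation `p' = -p ∘ F'(x)` along a trajectory `x`.
Pairing `p` with the difference of `x` and the trajectory of a nearby control `w + h` gives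
`∫ p(B h)` up to an error of second order in `h` (`adjoint_apply_sub_eq_integral`). Since the adjoint
equation can be solved with any terminal value `l`, every functional `l` of the end-point is
differentiable, with differential `h ↦ ∫ p(B h)` (`hasFDerivAt_comp_endpoint`).

*Its differential is onto.* If `l` annihilates the range of the differential, then `p ∘ B = 0` on
`[0, T]`. For the chain this says that the components of `p` dual to the momenta of the two end
particles vanish. Differentiating `p(t) v = 0` in time gives `p(t) (F'(x(t)) v) = 0`; applied twice,
this passes from one particle to its right neighbour, because the stiffness `Φ''` of each link is
nowhere zero. Hence `p = 0` (`adjoint_chain_eq_zero`), so `l = 0`.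
-/

/-! ### Global solutions of ordinary differential equations -/

lemma lipschitzWith_radial_retraction {E : Type*} [NormedAddCommGroup E] [NormedSpace ℝ E]
    {R : ℝ} (hR : 0 < R) : LipschitzWith 2 (fun x : E => (R / max R ‖x‖) • x) := by
  refine LipschitzWith.of_dist_le_mul fun x y => ?_
  rw [dist_eq_norm, dist_eq_norm]
  set a := max R ‖x‖ with ha
  set b := max R ‖y‖ with hb
  have haR : R ≤ a := le_max_left _ _
  have hbR : R ≤ b := le_max_left _ _
  have hyb : ‖y‖ ≤ b := le_max_right _ _
  have ha0 : 0 < a := hR.trans_le haR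
  have hb0 : 0 < b := hR.trans_le hbR
  have hab : |b - a| ≤ ‖x - y‖ := by
    have h1 : |b - a| ≤ |‖y‖ - ‖x‖| := by
      simpa [ha, hb, max_comm R] using abs_max_sub_max_le_abs ‖y‖ ‖x‖ R
    refine h1.trans ?_
    rw [norm_sub_rev]
    exact abs_norm_sub_norm_le y x
  have e : (R / a) • x - (R / b) • y = (R / a) • (x - y) + (R / a - R / b) • y := by
    module
  have h2 : R / a - R / b = R / a * ((b - a) / b) := by field_simp
  have h3 : R / a ≤ 1 := (div_le_one ha0).2 haR
  have h3' : 0 ≤ R / a := by positivity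
  have h4 : |R / a - R / b| * ‖y‖ ≤ |b - a| := by
    rw [h2, abs_mul, abs_of_nonneg h3', abs_div, abs_of_pos hb0]
    calc R / a * (|b - a| / b) * ‖y‖ ≤ 1 * (|b - a| / b) * b := by gcongr
      _ = |b - a| := by field_simp
  calc ‖(R / a) • x - (R / b) • y‖ ≤ ‖(R / a) • (x - y)‖ + ‖(R / a - R / b) • y‖ := by
        rw [e]; exact norm_add_le _ _
    _ ≤ 1 * ‖x - y‖ + |b - a| := by
        rw [norm_smul, norm_smul, Real.norm_eq_abs, Real.norm_eq_abs, abs_of_nonneg h3']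
        gcongr
    _ ≤ 2 * ‖x - y‖ := by linarith

/-- Global existence from an a priori bound: the vector field is truncated outside a ball larger
than the bound, so that Picard-Lindelöf gives a solution on the whole interval at once, and by the
bound that solution never reaches the region where the field was changed. -/
theorem exists_solution_of_apriori_bound {E : Type*} [NormedAddCommGroup E] [NormedSpace ℝ E]
    [CompleteSpace E] {g : ℝ → E → E} {T : ℝ} (hT : 0 ≤ T) {y₀ : E} {R : ℝ}
    (hcont : ∀ y, ContinuousOn (fun t => g t y) (Icc 0 T))
    (hlip : ∀ r : ℝ, ∃ K : NNReal, ∀ t ∈ Icc 0 T, LipschitzOnWith K (g t) (Metric.closedBall 0 r))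
    (hbound : ∀ τ ∈ Icc 0 T, ∀ y : ℝ → E, y 0 = y₀ →
      (∀ t ∈ Icc 0 τ, HasDerivWithinAt y (g t (y t)) (Icc 0 τ) t) → ‖y τ‖ ≤ R) :
    ∃ y : ℝ → E, y 0 = y₀ ∧ ∀ t ∈ Icc 0 T, HasDerivWithinAt y (g t (y t)) (Icc 0 T) t := by
  have hy₀ : ‖y₀‖ ≤ R := hbound 0 ⟨le_rfl, hT⟩ (fun _ => y₀) rfl fun t ht => by
    rw [Icc_self, mem_singleton_iff] at *
    subst ht
    exact HasFDerivWithinAt.of_subsingleton subsingleton_singleton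
  have hR : 0 ≤ R := (norm_nonneg _).trans hy₀
  set S := R + 1 with hS
  have hS0 : 0 < S := by positivity
  obtain ⟨K, hK⟩ := hlip S
  set r : E → E := fun x => (S / max S ‖x‖) • x with hr
  have hr_mem : ∀ x, r x ∈ Metric.closedBall (0 : E) S := fun x => by
    have h0 : 0 < max S ‖x‖ := hS0.trans_le (le_max_left _ _)
    rw [mem_closedBall_zero_iff, hr, norm_smul, Real.norm_eq_abs, abs_of_pos (by positivity)]
    calc S / max S ‖x‖ * ‖x‖ ≤ S / max S ‖x‖ * max S ‖x‖ := by gcongr; exact le_max_right _ _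
      _ = S := by field_simp
  have hr_eq : ∀ x, ‖x‖ ≤ S → r x = x := fun x hx => by
    simp only [hr, max_eq_left hx, div_self hS0.ne', one_smul]
  obtain ⟨M, hM⟩ : ∃ M, ∀ t ∈ Icc 0 T, ‖g t 0‖ ≤ M :=
    isCompact_Icc.exists_bound_of_continuousOn (hcont 0)
  have hM0 : 0 ≤ M := (norm_nonneg _).trans (hM 0 ⟨le_rfl, hT⟩)
  set L : NNReal := ⟨M, hM0⟩ + K * ⟨S, hS0.le⟩ with hL
  -- The truncated field is bounded by `L`, so a solution moves by at most `L * T`: a ball of that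
  -- radius makes the Picard-Lindelöf theorem apply on the whole interval.
  have hPL : IsPicardLindelof (fun t y => g t (r y)) (⟨0, le_rfl, hT⟩ : Icc (0 : ℝ) T) y₀
      (L * ⟨T, hT⟩) 0 L (K * 2) := by
    refine ⟨fun t ht => ?_, fun x _ => hcont (r x), fun t ht x _ => ?_, ?_⟩
    · have := (hK t ht).comp (lipschitzWith_radial_retraction hS0).lipschitzOnWith
        (s := univ) fun x _ => hr_mem x
      exact this.mono (subset_univ _)
    · have h0 : (0 : E) ∈ Metric.closedBall (0 : E) S := by simpa using hS0.le
      have h1 := (hK t ht).dist_le_mul _ (hr_mem x) _ h0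
      have h2 : dist (r x) 0 ≤ S := hr_mem x
      rw [dist_eq_norm] at h1
      calc ‖g t (r x)‖ ≤ ‖g t 0‖ + ‖g t (r x) - g t 0‖ := by
            simpa using norm_add_le (g t 0) (g t (r x) - g t 0)
        _ ≤ M + K * S := add_le_add (hM t ht) (h1.trans (by gcongr))
        _ = L := rfl
    · simp [hT]
      rfl
  obtain ⟨y, hy0, hy⟩ := hPL.exists_eq_forall_mem_Icc_hasDerivWithinAt₀
  replace hy0 : y 0 = y₀ := hy0
  have hyc : ContinuousOn y (Icc 0 T) := fun t ht => (hy t ht).continuousWithinAt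
  have hnc : ContinuousOn (fun t => ‖y t‖) (Icc 0 T) := hyc.norm
  -- While the truncated solution stays in the large ball, it solves the original equation.
  have key : ∀ τ ∈ Icc 0 T, (∀ t ∈ Icc 0 τ, ‖y t‖ ≤ S) → ‖y τ‖ ≤ R := fun τ hτ h =>
    hbound τ hτ y hy0 fun t ht => by
      have := (hy t ⟨ht.1, ht.2.trans hτ.2⟩).mono (Icc_subset_Icc_right hτ.2)
      rwa [hr_eq _ (h t ht)] at this
  have hle : ∀ t ∈ Icc 0 T, ‖y t‖ ≤ S := by
    by_contra! hcon
    obtain ⟨t₁, ht₁, hlt⟩ := hcon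
    have ivt : ∀ t ∈ Icc 0 T, S < ‖y t‖ → ∃ s ∈ Icc 0 t, ‖y s‖ = S := fun t ht h => by
      have := intermediate_value_Icc ht.1 (hnc.mono (Icc_subset_Icc_right ht.2))
      exact this ⟨by rw [hy0]; linarith, h.le⟩
    -- The first time at which the solution reaches the large sphere.
    have hcomp : IsCompact (Icc 0 T ∩ (fun t => ‖y t‖) ⁻¹' {S}) :=
      isCompact_Icc.of_isClosed_subset (hnc.preimage_isClosed_of_isClosed isClosed_Icc
        isClosed_singleton) inter_subset_left
    obtain ⟨s, hs, hsS⟩ := ivt t₁ ht₁ hlt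
    obtain ⟨τ, ⟨hτ, hτS⟩, hmin⟩ := hcomp.exists_isLeast
      ⟨s, ⟨hs.1, hs.2.trans ht₁.2⟩, hsS⟩
    have := key τ hτ fun t ht => by
      by_contra! h
      obtain ⟨s', hs', hs'S⟩ := ivt t ⟨ht.1, ht.2.trans hτ.2⟩ h
      have h1 : τ ≤ s' := hmin ⟨⟨hs'.1, hs'.2.trans (ht.2.trans hτ.2)⟩, hs'S⟩
      have h2 : t = τ := le_antisymm ht.2 (h1.trans hs'.2)
      rw [h2] at h
      exact h.ne' hτS
    have h3 : ‖y τ‖ = S := hτS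
    linarith
  refine ⟨y, hy0, fun t ht => ?_⟩
  have := hy t ht
  rwa [hr_eq _ (hle t ht)] at this

/-- Linear equations on a compact interval have global solutions: Grönwall's inequality provides
the a priori bound. -/
theorem exists_solution_of_linear {E : Type*} [NormedAddCommGroup E] [NormedSpace ℝ E]
    [CompleteSpace E] {A : ℝ → E →L[ℝ] E} {T : ℝ} (hT : 0 ≤ T)
    (hA : ContinuousOn A (Icc 0 T)) (y₀ : E) :
    ∃ y : ℝ → E, y 0 = y₀ ∧ ∀ t ∈ Icc 0 T, HasDerivWithinAt y (A t (y t)) (Icc 0 T) t := by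
  obtain ⟨M, hM⟩ := isCompact_Icc.exists_bound_of_continuousOn hA
  have hM0 : 0 ≤ M := (norm_nonneg _).trans (hM 0 ⟨le_rfl, hT⟩)
  refine exists_solution_of_apriori_bound (g := fun t y => A t y) hT
    (R := gronwallBound ‖y₀‖ M 0 T) (fun y => hA.clm_apply continuousOn_const) (fun r => ?_) ?_
  · refine ⟨⟨M, hM0⟩, fun t ht => ((A t).lipschitz.weaken ?_).lipschitzOnWith⟩
    exact hM t ht
  · intro τ hτ y hy0 hy
    have h1 := norm_le_gronwallBound_of_norm_deriv_right_le (f := y) (f' := fun t => A t (y t))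
      (δ := ‖y₀‖) (K := M) (ε := 0) (a := 0) (b := τ)
      (fun t ht => (hy t ht).continuousWithinAt)
      (fun t ht => (hy t (Ico_subset_Icc_self ht)).mono_of_mem_nhdsWithin
        (Icc_mem_nhdsGE_of_mem ht)) (by rw [hy0])
      (fun t ht => by
        rw [add_zero]
        exact (A t).le_of_opNorm_le (hM t ⟨ht.1, ht.2.le.trans hτ.2⟩) _) τ ⟨hτ.1, le_rfl⟩
    refine h1.trans (gronwallBound_mono (norm_nonneg _) le_rfl hM0 ?_)
    linarith [hτ.2]

/-- The adjoint equation `λ' = -λ ∘ A(t)` can be solved with any prescribed terminal value. -/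
theorem exists_adjoint_solution {X : Type*} [NormedAddCommGroup X] [NormedSpace ℝ X]
    {A : ℝ → X →L[ℝ] X} {T : ℝ} (hT : 0 ≤ T) (hA : ContinuousOn A (Icc 0 T)) (l : X →L[ℝ] ℝ) :
    ∃ p : ℝ → X →L[ℝ] ℝ, p T = l ∧
      ∀ t ∈ Icc 0 T, HasDerivWithinAt p (-(p t).comp (A t)) (Icc 0 T) t := by
  have hmaps : MapsTo (fun t : ℝ => T - t) (Icc 0 T) (Icc 0 T) := fun t ht =>
    ⟨by linarith [ht.2], by linarith [ht.1]⟩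
  obtain ⟨y, hy0, hy⟩ := exists_solution_of_linear
    (A := fun t => (ContinuousLinearMap.compL ℝ X X ℝ).flip (A (T - t))) hT
    ((ContinuousLinearMap.continuous _).comp_continuousOn
      (hA.comp (by fun_prop) hmaps)) l
  refine ⟨fun t => y (T - t), by simpa using hy0, fun t ht => ?_⟩
  have h1 := (hy (T - t) (hmaps ht)).scomp t
    (((hasDerivAt_id t).const_sub T).hasDerivWithinAt (s := Icc 0 T)) hmaps
  simpa using! h1

/-! ### The chain rule along indefinite integrals -/

/-- A function whose increments are controlled by those of an absolutely continuous function is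
absolutely continuous. -/
lemma AbsolutelyContinuousOnInterval.of_dist_le {X Y : Type*} [PseudoMetricSpace X]
    [PseudoMetricSpace Y] {f : ℝ → X} {g : ℝ → Y} {a b K : ℝ} (hK : 0 ≤ K)
    (hg : AbsolutelyContinuousOnInterval g a b)
    (h : ∀ s ∈ uIcc a b, ∀ t ∈ uIcc a b, dist (f s) (f t) ≤ K * dist (g s) (g t)) :
    AbsolutelyContinuousOnInterval f a b := by
  rw [absolutelyContinuousOnInterval_iff] at *
  intro ε hε
  obtain ⟨δ, hδ, H⟩ := hg (ε / (K + 1)) (by positivity)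
  refine ⟨δ, hδ, fun I hI hlt => ?_⟩
  calc ∑ i ∈ Finset.range I.1, dist (f (I.2 i).1) (f (I.2 i).2)
      ≤ ∑ i ∈ Finset.range I.1, K * dist (g (I.2 i).1) (g (I.2 i).2) :=
        Finset.sum_le_sum fun i hi => h _ (hI.1 i hi).1 _ (hI.1 i hi).2
    _ = K * ∑ i ∈ Finset.range I.1, dist (g (I.2 i).1) (g (I.2 i).2) := (Finset.mul_sum ..).symm
    _ ≤ K * (ε / (K + 1)) := by gcongr; exact (H I hI hlt).le
    _ < (K + 1) * (ε / (K + 1)) := by gcongr; linarith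
    _ = ε := by field_simp

/-- The chain rule along an indefinite integral: if `z` is an antiderivative of the integrable
function `w`, then `V ∘ z` is an antiderivative of `V'(z) w`. -/
theorem sub_eq_integral_fderiv_of_eq_integral {E : Type*} [NormedAddCommGroup E] [NormedSpace ℝ E]
    [CompleteSpace E] {V : E → ℝ} (hV : ContDiff ℝ 1 V) {z w : ℝ → E} {a b : ℝ} (hab : a ≤ b)
    (hw : IntervalIntegrable w volume a b) (hzc : ContinuousOn z (Icc a b))
    (hz : ∀ t ∈ Icc a b, z t = z a + ∫ s in a..t, w s) :
    V (z b) - V (z a) = ∫ t in a..b, fderiv ℝ V (z t) (w t) := by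
  have huI : uIcc a b = Icc a b := uIcc_of_le hab
  obtain ⟨K, hK⟩ := LocallyLipschitzOn.exists_lipschitzOnWith_of_compact
    (isCompact_Icc.image_of_continuousOn hzc) hV.locallyLipschitz.locallyLipschitzOn
  have hint : ∀ s ∈ Icc a b, ∀ t ∈ Icc a b, IntervalIntegrable w volume s t := fun s hs t ht =>
    hw.mono_set (by rw [huI]; exact uIcc_subset_Icc hs ht)
  have ha : a ∈ Icc a b := ⟨le_rfl, hab⟩
  have hAC : AbsolutelyContinuousOnInterval (fun t => V (z t)) a b := by
    refine AbsolutelyContinuousOnInterval.of_dist_le (K := K) K.2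
      (hw.norm.absolutelyContinuousOnInterval_intervalIntegral (c := a) left_mem_uIcc) ?_
    rw [huI]
    intro s hs t ht
    refine (hK.dist_le_mul _ (mem_image_of_mem z hs) _ (mem_image_of_mem z ht)).trans ?_
    gcongr
    rw [dist_comm, dist_comm (∫ v in a..s, ‖w v‖), dist_eq_norm, Real.dist_eq, hz s hs, hz t ht,
      add_sub_add_left_eq_sub,
      intervalIntegral.integral_interval_sub_left (hint a ha t ht) (hint a ha s hs),
      intervalIntegral.integral_interval_sub_left (hint a ha t ht).norm (hint a ha s hs).norm]
    exact intervalIntegral.norm_integral_le_abs_integral_norm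
  rw [← hAC.integral_deriv_eq_sub]
  have h1 : ∀ᵐ x : ℝ, x ≠ a := by simp [ae_iff, measure_singleton]
  have h2 : ∀ᵐ x : ℝ, x ≠ b := by simp [ae_iff, measure_singleton]
  refine intervalIntegral.integral_congr_ae ?_
  filter_upwards [hw.ae_hasDerivAt_integral, h1, h2] with t ht hta htb htm
  rw [uIoc_of_le hab] at htm
  have htI : t ∈ Icc a b := Ioc_subset_Icc_self htm
  have hd : HasDerivAt z (w t) t := by
    refine ((ht (huI ▸ htI) a left_mem_uIcc).const_add (z a)).congr_of_eventuallyEq ?_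
    filter_upwards [Icc_mem_nhds htm.1 (lt_of_le_of_ne htm.2 htb)] with s hs using hz s hs
  exact ((hV.differentiable one_ne_zero (z t)).hasFDerivAt.comp_hasDerivAt t hd).deriv

/-! ### Bounded inputs and trajectories -/

/-- The input `u` is integrable on `[0, T]` and essentially bounded by `M` there. -/
structure IsBoundedInput {U : Type*} [NormedAddCommGroup U] (u : ℝ → U) (T M : ℝ) : Prop where
  intervalIntegrable : IntervalIntegrable u volume 0 T
  ae_norm_le : ∀ᵐ t ∂volume.restrict (Icc 0 T), ‖u t‖ ≤ M

lemma ae_restrict_uIoc_of_ae_restrict_Icc {T : ℝ} (hT : 0 ≤ T) {p : ℝ → Prop}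
    (h : ∀ᵐ t ∂volume.restrict (Icc 0 T), p t) : ∀ᵐ t, t ∈ uIoc 0 T → p t := by
  rw [ae_restrict_iff' measurableSet_Icc] at h
  filter_upwards [h] with t ht htm
  rw [uIoc_of_le hT] at htm
  exact ht (Ioc_subset_Icc_self htm)

lemma IsBoundedInput.mono {U : Type*} [NormedAddCommGroup U] {u : ℝ → U} {T M τ : ℝ}
    (hu : IsBoundedInput u T M)
    (hτ : τ ∈ Icc 0 T) : IsBoundedInput u τ M where
  intervalIntegrable := hu.intervalIntegrable.mono_set (by
    rw [uIcc_of_le hτ.1, uIcc_of_le (hτ.1.trans hτ.2)]; exact Icc_subset_Icc_right hτ.2)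
  ae_norm_le := ae_restrict_of_ae_restrict_of_subset (Icc_subset_Icc_right hτ.2) hu.ae_norm_le

lemma IsBoundedInput.weaken {U : Type*} [NormedAddCommGroup U] {u : ℝ → U} {T M M' : ℝ}
    (hu : IsBoundedInput u T M) (h : M ≤ M') : IsBoundedInput u T M' :=
  ⟨hu.1, hu.2.mono fun _ ht => ht.trans h⟩

lemma ControlSpace.isBoundedInput {U : Type*} [NormedAddCommGroup U] {T : ℝ} (hT : 0 ≤ T)
    (u : ControlSpace U T) : IsBoundedInput u T ‖u‖ where
  intervalIntegrable := by
    have h : IntegrableOn u (Icc 0 T) := (Lp.memLp u).integrable le_top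
    exact (intervalIntegrable_iff_integrableOn_Icc_of_le hT).2 h
  ae_norm_le := by
    rw [Lp.norm_def]
    have h1 := ae_le_eLpNormEssSup (f := u) (μ := volume.restrict (Icc 0 T))
    have h2 : eLpNorm u ⊤ (volume.restrict (Icc 0 T)) ≠ ⊤ := (Lp.memLp u).eLpNorm_ne_top
    rw [eLpNorm_exponent_top] at *
    filter_upwards [h1] with t ht
    rw [← toReal_enorm]
    exact ENNReal.toReal_mono h2 ht

lemma IsTrajectory.mono {X U : Type*} [NormedAddCommGroup X] [NormedSpace ℝ X] {f : X → U → X}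
    {T τ : ℝ} {x₀ : X} {u : ℝ → U} {x : ℝ → X}
    (hx : IsTrajectory f T x₀ u x) (hτ : τ ∈ Icc 0 T) : IsTrajectory f τ x₀ u x where
  continuousOn := hx.continuousOn.mono (Icc_subset_Icc_right hτ.2)
  integrable := hx.integrable.mono_set (by
    rw [uIcc_of_le hτ.1, uIcc_of_le (hτ.1.trans hτ.2)]; exact Icc_subset_Icc_right hτ.2)
  eq_integral t ht := hx.eq_integral t ⟨ht.1, ht.2.trans hτ.2⟩

lemma IsTrajectory.apply_zero {X U : Type*} [NormedAddCommGroup X] [NormedSpace ℝ X] {f : X → U → X}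
    {T : ℝ} (hT : 0 ≤ T) {x₀ : X} {u : ℝ → U} {x : ℝ → X} (hx : IsTrajectory f T x₀ u x) :
    x 0 = x₀ := by
  simpa using hx.eq_integral 0 ⟨le_rfl, hT⟩

section ControlAffine

variable {X U : Type*} [NormedAddCommGroup X] [NormedSpace ℝ X]
  [NormedAddCommGroup U] [NormedSpace ℝ U]

/-- Trajectories of `x' = F(x) + B u` admit a bound that depends only on the initial point, on the
time horizon and on the size of the input, even if they are only defined up to a time `τ ≤ T`. -/
def HasAprioriBounds (F : X → X) (B : U →L[ℝ] X) : Prop :=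
  ∀ (x₀ : X) (T M : ℝ), ∃ R : ℝ, ∀ τ ∈ Icc 0 T, ∀ u : ℝ → U, IsBoundedInput u τ M →
    ∀ x : ℝ → X, IsTrajectory (fun x w => F x + B w) τ x₀ u x → ∀ t ∈ Icc 0 τ, ‖x t‖ ≤ R

lemma IsBoundedInput.intervalIntegrable_comp {u : ℝ → U} {T M : ℝ} (hu : IsBoundedInput u T M)
    (B : U →L[ℝ] X) : IntervalIntegrable (fun s => B (u s)) volume 0 T :=
  ⟨B.integrable_comp hu.1.1, B.integrable_comp hu.1.2⟩

lemma IsBoundedInput.norm_integral_le {u : ℝ → U} {T M : ℝ} (hu : IsBoundedInput u T M)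
    (hM : 0 ≤ M) (B : U →L[ℝ] X) {t : ℝ} (ht : t ∈ Icc 0 T) :
    ‖∫ s in (0 : ℝ)..t, B (u s)‖ ≤ ‖B‖ * T * M := by
  have h1 := intervalIntegral.norm_integral_le_of_norm_le_const_ae (a := 0) (b := t)
    (f := fun s => B (u s)) (C := ‖B‖ * M) (by
      filter_upwards [ae_restrict_uIoc_of_ae_restrict_Icc ht.1 (hu.mono ht).2] with s hs hsm
      exact (B.le_opNorm _).trans (by gcongr; exact hs hsm))
  refine h1.trans ?_
  rw [sub_zero, abs_of_nonneg ht.1]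
  have := ht.2
  calc ‖B‖ * M * t ≤ ‖B‖ * M * T := by gcongr
    _ = _ := by ring

/-- Subtracting the integrated input from a trajectory leaves a classical solution of an equation
with continuous right-hand side. -/
lemma IsTrajectory.hasDerivWithinAt [CompleteSpace X] {F : X → X} (hF : Continuous F)
    {B : U →L[ℝ] X} {T M : ℝ} {x₀ : X} {u : ℝ → U} {x : ℝ → X} (hu : IsBoundedInput u T M)
    (hx : IsTrajectory (fun x w => F x + B w) T x₀ u x) {t : ℝ} (ht : t ∈ Icc 0 T) :
    HasDerivWithinAt (fun t => x t - ∫ s in (0 : ℝ)..t, B (u s)) (F (x t)) (Icc 0 T) t := by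
  have h1 := ODE.hasDerivWithinAt_picard_Icc (f := fun _ x => F x) (u := univ)
    (t₀ := 0) (tmin := 0) (tmax := T) (α := x) ⟨le_rfl, ht.1.trans ht.2⟩
    (by fun_prop) hx.continuousOn (fun _ _ => mem_univ _) x₀ ht
  refine h1.congr_of_mem (fun s hs => ?_) ht
  rw [ODE.picard_apply, hx.eq_integral s hs, intervalIntegral.integral_add, add_sub_assoc,
    add_sub_cancel_right]
  · exact (hF.comp_continuousOn (hx.mono hs).continuousOn).intervalIntegrable_of_Icc hs.1
  · exact (hu.mono hs).intervalIntegrable_comp B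

lemma isTrajectory_of_hasDerivWithinAt [CompleteSpace X] {F : X → X} (hF : Continuous F)
    {B : U →L[ℝ] X} {T M : ℝ} {x₀ : X} {u : ℝ → U} {y : ℝ → X} (hu : IsBoundedInput u T M)
    (hT : 0 ≤ T) (hy0 : y 0 = x₀)
    (hy : ∀ t ∈ Icc 0 T,
      HasDerivWithinAt y (F (y t + ∫ s in (0 : ℝ)..t, B (u s))) (Icc 0 T) t) :
    IsTrajectory (fun x w => F x + B w) T x₀ u (fun t => y t + ∫ s in (0 : ℝ)..t, B (u s)) := by
  have hB := hu.intervalIntegrable_comp B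
  have hyc : ContinuousOn y (Icc 0 T) := fun t ht => (hy t ht).continuousWithinAt
  have hxc : ContinuousOn (fun t => y t + ∫ s in (0 : ℝ)..t, B (u s)) (Icc 0 T) := by
    have := intervalIntegral.continuousOn_primitive_interval' hB left_mem_uIcc
    rw [uIcc_of_le hT] at this
    exact hyc.add this
  have hFx := hF.comp_continuousOn hxc
  have hFi : ∀ t ∈ Icc 0 T, IntervalIntegrable
      (fun s => F (y s + ∫ r in (0 : ℝ)..s, B (u r))) volume 0 t := fun t ht =>
    (hFx.mono (Icc_subset_Icc_right ht.2)).intervalIntegrable_of_Icc ht.1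
  refine ⟨hxc, (hFi T ⟨hT, le_rfl⟩).add hB, fun t ht => ?_⟩
  have h1 := intervalIntegral.integral_eq_sub_of_hasDerivAt_of_le ht.1
    (hyc.mono (Icc_subset_Icc_right ht.2)) (fun s hs =>
      (hy s ⟨hs.1.le, hs.2.le.trans ht.2⟩).hasDerivAt
      (Icc_mem_nhds hs.1 (hs.2.trans_le ht.2))) (hFi t ht)
  rw [intervalIntegral.integral_add (hFi t ht) ((hu.mono ht).intervalIntegrable_comp B), h1, hy0]
  abel

/-- With zero initial error, the Grönwall bound is linear in the size of the perturbation. -/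
lemma gronwallBound_zero_mul (K c ε x : ℝ) :
    gronwallBound 0 K (c * ε) x = gronwallBound 0 K c x * ε := by
  unfold gronwallBound
  split_ifs <;> ring

/-- Lipschitz dependence of the trajectory on the input. -/
lemma norm_sub_le_of_isTrajectory [CompleteSpace X] {F : X → X} (hF : Continuous F)
    {B : U →L[ℝ] X} {T M M' R ε : ℝ} {K : NNReal} {x₀ : X} {u u' : ℝ → U} {x x' : ℝ → X}
    (hK : LipschitzOnWith K F (Metric.closedBall 0 R))
    (hu : IsBoundedInput u T M) (hu' : IsBoundedInput u' T M')
    (hx : IsTrajectory (fun x w => F x + B w) T x₀ u x)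
    (hx' : IsTrajectory (fun x w => F x + B w) T x₀ u' x')
    (hxR : ∀ t ∈ Icc 0 T, ‖x t‖ ≤ R) (hxR' : ∀ t ∈ Icc 0 T, ‖x' t‖ ≤ R)
    (hε : 0 ≤ ε) (hd : IsBoundedInput (fun t => u' t - u t) T ε) {t : ℝ} (ht : t ∈ Icc 0 T) :
    ‖x' t - x t‖ ≤ (gronwallBound 0 K (K * (‖B‖ * T)) T + ‖B‖ * T) * ε := by
  have hT : 0 ≤ T := ht.1.trans ht.2
  -- Unlike `x' - x`, the function `d` is differentiable everywhere, so Grönwall applies to it.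
  set d : ℝ → X := fun t => (x' t - ∫ s in (0 : ℝ)..t, B (u' s)) -
    (x t - ∫ s in (0 : ℝ)..t, B (u s)) with hdd
  have hder : ∀ t ∈ Icc 0 T, HasDerivWithinAt d (F (x' t) - F (x t)) (Icc 0 T) t := fun t ht =>
    (hx'.hasDerivWithinAt hF hu' ht).sub (hx.hasDerivWithinAt hF hu ht)
  have hsplit : ∀ t ∈ Icc 0 T, x' t - x t = d t + ∫ s in (0 : ℝ)..t, B (u' s - u s) :=
    fun t ht => by
      simp only [hdd, map_sub]
      rw [intervalIntegral.integral_sub ((hu'.mono ht).intervalIntegrable_comp B)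
        ((hu.mono ht).intervalIntegrable_comp B)]
      abel
  have hle : ∀ t ∈ Icc 0 T, ‖x' t - x t‖ ≤ ‖d t‖ + ‖B‖ * T * ε := fun t ht => by
    rw [hsplit t ht]
    exact (norm_add_le _ _).trans (by gcongr; exact hd.norm_integral_le hε B ht)
  have h1 := norm_le_gronwallBound_of_norm_deriv_right_le (f := d)
    (f' := fun t => F (x' t) - F (x t)) (δ := 0) (K := K) (ε := K * (‖B‖ * T) * ε) (a := 0) (b := T)
    (fun t ht => (hder t ht).continuousWithinAt)
    (fun t ht => (hder t (Ico_subset_Icc_self ht)).mono_of_mem_nhdsWithin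
      (Icc_mem_nhdsGE_of_mem ht))
    (by simp [hdd, hx.apply_zero hT, hx'.apply_zero hT])
    (fun t ht => by
      have htI := Ico_subset_Icc_self ht
      have := hK.dist_le_mul _ (mem_closedBall_zero_iff.2 (hxR' t htI)) _
        (mem_closedBall_zero_iff.2 (hxR t htI))
      rw [dist_eq_norm, dist_eq_norm] at this
      calc ‖F (x' t) - F (x t)‖ ≤ K * (‖d t‖ + ‖B‖ * T * ε) :=
            this.trans (by gcongr; exact hle t htI)
        _ = _ := by ring) t ht
  rw [sub_zero, gronwallBound_zero_mul] at h1
  have h2 : gronwallBound 0 K (K * (‖B‖ * T)) t ≤ gronwallBound 0 K (K * (‖B‖ * T)) T :=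
    gronwallBound_mono le_rfl (by positivity) K.2 ht.2
  calc ‖x' t - x t‖ ≤ ‖d t‖ + ‖B‖ * T * ε := hle t ht
    _ ≤ gronwallBound 0 K (K * (‖B‖ * T)) T * ε + ‖B‖ * T * ε := by
        gcongr; exact h1.trans (by gcongr)
    _ = _ := by ring

/-- The duality between the difference of two trajectories and a solution of the adjoint equation
along the first of them. The last term is of second order in the difference. -/
lemma adjoint_apply_sub_eq_integral [CompleteSpace X] {F : X → X}
    {B : U →L[ℝ] X} {T : ℝ} (hT : 0 ≤ T) {x₀ : X} {u u' : ℝ → U} {x x' : ℝ → X}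
    (hx : IsTrajectory (fun x w => F x + B w) T x₀ u x)
    (hx' : IsTrajectory (fun x w => F x + B w) T x₀ u' x')
    {A : ℝ → X →L[ℝ] X} (hA : ContinuousOn A (Icc 0 T)) {p : ℝ → X →L[ℝ] ℝ}
    (hp : ∀ t ∈ Icc 0 T, HasDerivWithinAt p (-(p t).comp (A t)) (Icc 0 T) t) :
    p T (x' T - x T) = ∫ t in (0 : ℝ)..T,
      (p t (B (u' t - u t)) + p t (F (x' t) - F (x t) - A t (x' t - x t))) := by
  have hpc : ContinuousOn p (Icc 0 T) := fun t ht => (hp t ht).continuousWithinAt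
  have hpi : IntervalIntegrable (fun t => -(p t).comp (A t)) volume 0 T :=
    (hpc.clm_comp hA).neg.intervalIntegrable_of_Icc hT
  set w : ℝ → (X →L[ℝ] ℝ) × X := fun t =>
    (-(p t).comp (A t), (F (x' t) + B (u' t)) - (F (x t) + B (u t))) with hw
  have hwi : IntervalIntegrable w volume 0 T := by
    have h2 := hx'.integrable.sub hx.integrable
    exact ⟨hpi.1.prodMk h2.1, hpi.2.prodMk h2.2⟩
  have hV : ContDiff ℝ 1 (fun z : (X →L[ℝ] ℝ) × X => z.1 z.2) :=
    isBoundedBilinearMap_apply.contDiff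
  have h := sub_eq_integral_fderiv_of_eq_integral hV (z := fun t => (p t, x' t - x t)) hT hwi
    (hpc.prodMk (hx'.continuousOn.sub hx.continuousOn)) (fun t ht => by
      have hwt : IntervalIntegrable w volume 0 t := hwi.mono_set (by
        rw [uIcc_of_le hT, uIcc_of_le ht.1]; exact Icc_subset_Icc_right ht.2)
      have h2 : ∫ s in (0 : ℝ)..t, w s =
          (∫ s in (0 : ℝ)..t, (w s).1, ∫ s in (0 : ℝ)..t, (w s).2) := by
        ext1
        · exact ((ContinuousLinearMap.fst ℝ (X →L[ℝ] ℝ) X).intervalIntegral_comp_comm hwt).symm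
        · exact ((ContinuousLinearMap.snd ℝ (X →L[ℝ] ℝ) X).intervalIntegral_comp_comm hwt).symm
      rw [h2, Prod.mk_add_mk]
      ext1
      · have := intervalIntegral.integral_eq_sub_of_hasDerivAt_of_le ht.1
          (hpc.mono (Icc_subset_Icc_right ht.2)) (fun s hs =>
            (hp s ⟨hs.1.le, hs.2.le.trans ht.2⟩).hasDerivAt
              (Icc_mem_nhds hs.1 (hs.2.trans_le ht.2)))
          (hpi.mono_set (by rw [uIcc_of_le hT, uIcc_of_le ht.1]; exact Icc_subset_Icc_right ht.2))
        simp only [hw, this, add_sub_cancel]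
      · simp only [hw]
        rw [intervalIntegral.integral_sub (hx'.mono ht).integrable (hx.mono ht).integrable,
          hx.eq_integral t ht, hx'.eq_integral t ht, hx.apply_zero hT, hx'.apply_zero hT]
        abel)
  simp only [hx.apply_zero hT, hx'.apply_zero hT, sub_self, map_zero, sub_zero] at h
  rw [h]
  refine intervalIntegral.integral_congr fun t _ => ?_
  have hd : HasFDerivAt (fun z : (X →L[ℝ] ℝ) × X => z.1 z.2) _ (p t, x' t - x t) :=
    (hasFDerivAt_fst (𝕜 := ℝ)).clm_apply hasFDerivAt_snd
  simp only [hd.fderiv, hw]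
  simp
  ring

end ControlAffine

/-! ### The end-point map and its differential -/

section EndpointMap

variable {X U : Type*} [NormedAddCommGroup X] [NormedSpace ℝ X] [FiniteDimensional ℝ X]
  [NormedAddCommGroup U] [NormedSpace ℝ U]

lemma exists_lipschitzOnWith_closedBall {Y : Type*} [NormedAddCommGroup Y] [NormedSpace ℝ Y]
    {F : X → Y} (hF : ContDiff ℝ 1 F) (r : ℝ) :
    ∃ K : NNReal, LipschitzOnWith K F (Metric.closedBall 0 r) :=
  have := FiniteDimensional.proper_real X
  hF.contDiffOn.exists_lipschitzOnWith one_ne_zero (convex_closedBall _ _)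
    (isCompact_closedBall _ _)

/-- The first-order Taylor remainder is quadratic, uniformly on balls. -/
lemma exists_norm_sub_sub_fderiv_le {F : X → X} (hF : ContDiff ℝ 2 F) (r : ℝ) :
    ∃ C : ℝ, 0 ≤ C ∧ ∀ x ∈ Metric.closedBall (0 : X) r, ∀ y ∈ Metric.closedBall (0 : X) r,
      ‖F y - F x - fderiv ℝ F x (y - x)‖ ≤ C * ‖y - x‖ ^ 2 := by
  obtain ⟨K, hK⟩ := exists_lipschitzOnWith_closedBall (hF.fderiv_right (m := 1) le_rfl) r
  refine ⟨K, K.2, fun x hx y hy => ?_⟩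
  have hconv : Convex ℝ (Metric.closedBall (0 : X) r ∩ Metric.closedBall x ‖y - x‖) :=
    (convex_closedBall _ _).inter (convex_closedBall _ _)
  have h := hconv.norm_image_sub_le_of_norm_hasFDerivWithin_le' (f := F) (f' := fderiv ℝ F)
    (φ := fderiv ℝ F x) (C := K * ‖y - x‖) (x := x) (y := y)
    (fun z _ => ((hF.differentiable two_ne_zero) z).hasFDerivAt.hasFDerivWithinAt)
    (fun z hz => by
      have h1 := hK.dist_le_mul _ hz.1 _ hx
      have h2 : dist z x ≤ ‖y - x‖ := hz.2
      rw [dist_eq_norm] at h1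
      exact h1.trans (by gcongr))
    ⟨hx, by simp⟩ ⟨hy, by simp [dist_eq_norm]⟩
  rwa [mul_assoc, ← sq] at h

lemma exists_isTrajectory {F : X → X} (hF : ContDiff ℝ 1 F) {B : U →L[ℝ] X}
    (hAB : HasAprioriBounds F B) {T M : ℝ} (hT : 0 ≤ T) (hM : 0 ≤ M) (x₀ : X) {u : ℝ → U}
    (hu : IsBoundedInput u T M) :
    ∃ x, IsTrajectory (fun x w => F x + B w) T x₀ u x := by
  have := FiniteDimensional.complete ℝ X
  obtain ⟨R, hR⟩ := hAB x₀ T M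
  have hW : ∀ t ∈ Icc 0 T, ‖∫ s in (0 : ℝ)..t, B (u s)‖ ≤ ‖B‖ * T * M := fun t ht =>
    hu.norm_integral_le hM B ht
  have hWc : ContinuousOn (fun t => ∫ s in (0 : ℝ)..t, B (u s)) (Icc 0 T) := by
    have := intervalIntegral.continuousOn_primitive_interval' (hu.intervalIntegrable_comp B)
      left_mem_uIcc
    rwa [uIcc_of_le hT] at this
  obtain ⟨y, hy0, hy⟩ := exists_solution_of_apriori_bound
    (g := fun t y => F (y + ∫ s in (0 : ℝ)..t, B (u s))) hT (y₀ := x₀)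
    (R := R + ‖B‖ * T * M)
    (fun y => hF.continuous.comp_continuousOn (continuousOn_const.add hWc))
    (fun r => by
      obtain ⟨K, hK⟩ := exists_lipschitzOnWith_closedBall hF (r + ‖B‖ * T * M)
      refine ⟨K, fun t ht => LipschitzOnWith.of_dist_le_mul fun y hy z hz => ?_⟩
      have hmem : ∀ y ∈ Metric.closedBall (0 : X) r,
          y + ∫ s in (0 : ℝ)..t, B (u s) ∈ Metric.closedBall (0 : X) (r + ‖B‖ * T * M) :=
        fun y hy => by
          rw [mem_closedBall_zero_iff] at *
          exact (norm_add_le _ _).trans (add_le_add hy (hW t ht))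
      simpa using hK.dist_le_mul _ (hmem y hy) _ (hmem z hz))
    (fun τ hτ y hy0 hy => by
      have h1 := hR τ hτ u (hu.mono hτ) _
        (isTrajectory_of_hasDerivWithinAt hF.continuous (hu.mono hτ) hτ.1 hy0 hy) τ ⟨hτ.1, le_rfl⟩
      have h2 := hW τ hτ
      calc ‖y τ‖ = ‖(y τ + ∫ s in (0 : ℝ)..τ, B (u s)) - ∫ s in (0 : ℝ)..τ, B (u s)‖ := by simp
        _ ≤ _ := (norm_sub_le _ _).trans (add_le_add h1 h2))
  exact ⟨_, isTrajectory_of_hasDerivWithinAt hF.continuous hu hT hy0 hy⟩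

/-- A trajectory is determined by its initial point and its input: two trajectories of the same
input differ by at most a multiple of the zero difference of the inputs. -/
lemma eqOn_of_isTrajectory {F : X → X} (hF : ContDiff ℝ 1 F) {B : U →L[ℝ] X}
    (hAB : HasAprioriBounds F B) {T M : ℝ} {x₀ : X} {u : ℝ → U}
    (hu : IsBoundedInput u T M) {x x' : ℝ → X}
    (hx : IsTrajectory (fun x w => F x + B w) T x₀ u x)
    (hx' : IsTrajectory (fun x w => F x + B w) T x₀ u x') : EqOn x x' (Icc 0 T) := fun t ht => by
  have := FiniteDimensional.complete ℝ X
  obtain ⟨R, hR⟩ := hAB x₀ T M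
  obtain ⟨K, hK⟩ := exists_lipschitzOnWith_closedBall hF R
  have hTT : T ∈ Icc 0 T := ⟨ht.1.trans ht.2, le_rfl⟩
  have h := norm_sub_le_of_isTrajectory hF.continuous hK hu hu hx hx' (hR T hTT u hu x hx)
    (hR T hTT u hu x' hx') le_rfl ⟨by simp, by simp⟩ ht
  rw [mul_zero, norm_le_zero_iff, sub_eq_zero] at h
  exact h.symm

lemma intervalIntegrable_apply_of_isBoundedInput {T M : ℝ} (hT : 0 ≤ T) {q : ℝ → U →L[ℝ] ℝ}
    (hq : ContinuousOn q (Icc 0 T)) {u : ℝ → U} (hu : IsBoundedInput u T M) :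
    IntervalIntegrable (fun t => q t (u t)) volume 0 T := by
  obtain ⟨Q, hQ⟩ := isCompact_Icc.exists_bound_of_continuousOn hq
  have hui : IntegrableOn u (Icc 0 T) :=
    (intervalIntegrable_iff_integrableOn_Icc_of_le hT).1 hu.1
  refine (intervalIntegrable_iff_integrableOn_Icc_of_le hT).2 ?_
  have hm : AEStronglyMeasurable (fun t => q t (u t)) (volume.restrict (Icc 0 T)) :=
    isBoundedBilinearMap_apply.continuous.comp_aestronglyMeasurable
      ((hq.aestronglyMeasurable_of_isCompact isCompact_Icc measurableSet_Icc).prodMk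
        hui.aestronglyMeasurable)
  exact Integrable.mono' (hui.norm.const_mul Q) hm
    ((ae_restrict_mem measurableSet_Icc).mono fun t ht => (q t).le_of_opNorm_le (hQ t ht) _)

/-- Pairing an essentially bounded control with a continuous family of functionals, as a continuous
linear functional on the space of controls. -/
theorem exists_clm_eq_integral {T : ℝ} (hT : 0 ≤ T) {q : ℝ → U →L[ℝ] ℝ}
    (hq : ContinuousOn q (Icc 0 T)) :
    ∃ D : ControlSpace U T →L[ℝ] ℝ, ∀ h, D h = ∫ t in (0 : ℝ)..T, q t (h t) := by
  obtain ⟨Q, hQ⟩ := isCompact_Icc.exists_bound_of_continuousOn hq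
  have hint := fun h : ControlSpace U T =>
    intervalIntegrable_apply_of_isBoundedInput hT hq (ControlSpace.isBoundedInput hT h)
  refine ⟨LinearMap.mkContinuous
    { toFun := fun h => ∫ t in (0 : ℝ)..T, q t (h t)
      map_add' := fun h k => ?_
      map_smul' := fun c h => ?_ } (Q * T) fun h => ?_, fun h => rfl⟩
  · rw [← intervalIntegral.integral_add (hint h) (hint k)]
    refine intervalIntegral.integral_congr_ae ?_
    filter_upwards [ae_restrict_uIoc_of_ae_restrict_Icc hT (Lp.coeFn_add h k)] with t ht htm
    rw [ht htm]
    simp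
  · rw [RingHom.id_apply, ← intervalIntegral.integral_smul]
    refine intervalIntegral.integral_congr_ae ?_
    filter_upwards [ae_restrict_uIoc_of_ae_restrict_Icc hT (Lp.coeFn_smul c h)] with t ht htm
    rw [ht htm]
    simp
  · have := intervalIntegral.norm_integral_le_of_norm_le_const_ae (a := 0) (b := T)
      (f := fun t => q t (h t)) (C := Q * ‖h‖) (by
        filter_upwards [ae_restrict_uIoc_of_ae_restrict_Icc hT
          (ControlSpace.isBoundedInput hT h).2] with t ht htm
        have htI : t ∈ Icc 0 T := by
          rw [uIoc_of_le hT] at htm; exact Ioc_subset_Icc_self htm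
        have hQt := hQ t htI
        have hQ0 := (norm_nonneg _).trans hQt
        exact ((q t).le_of_opNorm_le hQt _).trans (by gcongr; exact ht htm))
    rw [sub_zero, abs_of_nonneg hT] at this
    refine this.trans (le_of_eq ?_)
    ring

/-- The differential of a linear functional of the end-point is the pairing of the control variation
with the solution of the adjoint equation along the reference trajectory. -/
theorem hasFDerivAt_comp_endpoint {F : X → X} (hF : ContDiff ℝ 2 F) {B : U →L[ℝ] X}
    (hAB : HasAprioriBounds F B) {T : ℝ} (hT : 0 ≤ T) {x₀ : X} {u : ControlSpace U T}
    {x : ControlSpace U T → ℝ → X}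
    (hx : ∀ v : ControlSpace U T, IsTrajectory (fun x w => F x + B w) T x₀ v (x v))
    {p : ℝ → X →L[ℝ] ℝ} (hp : ∀ t ∈ Icc 0 T,
      HasDerivWithinAt p (-(p t).comp (fderiv ℝ F (x u t))) (Icc 0 T) t)
    {D : ControlSpace U T →L[ℝ] ℝ} (hD : ∀ h, D h = ∫ t in (0 : ℝ)..T, p t (B (h t))) :
    HasFDerivAt (fun v => p T (x v T)) D u := by
  have := FiniteDimensional.complete ℝ X
  have hTT : T ∈ Icc 0 T := ⟨hT, le_rfl⟩
  have hbd : ∀ v : ControlSpace U T, IsBoundedInput v T ‖v‖ := ControlSpace.isBoundedInput hT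
  have hF1 : ContDiff ℝ 1 F := hF.of_le one_le_two
  have hA : ContinuousOn (fun t => fderiv ℝ F (x u t)) (Icc 0 T) :=
    (hF.continuous_fderiv two_ne_zero).comp_continuousOn (hx u).continuousOn
  have hpc : ContinuousOn p (Icc 0 T) := fun t ht => (hp t ht).continuousWithinAt
  obtain ⟨P, hP⟩ := isCompact_Icc.exists_bound_of_continuousOn hpc
  have hP0 : 0 ≤ P := (norm_nonneg _).trans (hP 0 ⟨le_rfl, hT⟩)
  -- All controls near `u` are bounded by one constant, hence so are their trajectories.
  obtain ⟨R, hR⟩ := hAB x₀ T (‖u‖ + 1)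
  obtain ⟨K, hK⟩ := exists_lipschitzOnWith_closedBall hF1 R
  obtain ⟨C, hC0, hC⟩ := exists_norm_sub_sub_fderiv_le hF R
  set G := gronwallBound 0 K (K * (‖B‖ * T)) T + ‖B‖ * T with hG
  have key : ∀ v : ControlSpace U T, ‖v - u‖ ≤ 1 →
      ‖p T (x v T) - p T (x u T) - D (v - u)‖ ≤ P * (C * G ^ 2) * T * ‖v - u‖ ^ 2 := fun v hv => by
    have hvn : ‖v‖ ≤ ‖u‖ + 1 := by
      calc ‖v‖ = ‖u + (v - u)‖ := by simp
        _ ≤ _ := (norm_add_le _ _).trans (by gcongr)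
    have huR := hR T hTT u ((hbd u).weaken (by linarith)) _ (hx u)
    have hvR := hR T hTT v ((hbd v).weaken hvn) _ (hx v)
    have hae : ∀ᵐ t ∂volume.restrict (Icc 0 T), (v - u) t = v t - u t := Lp.coeFn_sub v u
    have hd : IsBoundedInput (fun t => v t - u t) T ‖v - u‖ :=
      ⟨(hbd v).1.sub (hbd u).1, by
        filter_upwards [hae, (hbd (v - u)).2] with t ht1 ht2
        rwa [← ht1]⟩
    have hest : ∀ t ∈ Icc 0 T, ‖x v t - x u t‖ ≤ G * ‖v - u‖ := fun t ht =>
      norm_sub_le_of_isTrajectory hF.continuous hK (hbd u) (hbd v) (hx u) (hx v) huR hvR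
        (norm_nonneg _) hd ht
    have hI1 : IntervalIntegrable (fun t => p t (B (v t - u t))) volume 0 T :=
      intervalIntegrable_apply_of_isBoundedInput hT (q := fun t => (p t).comp B)
        (hpc.clm_comp continuousOn_const) hd
    have hI2 : IntervalIntegrable (fun t => p t (F (x v t) - F (x u t) -
        fderiv ℝ F (x u t) (x v t - x u t))) volume 0 T := by
      refine (hpc.clm_apply (((hF.continuous.comp_continuousOn (hx v).continuousOn).sub
        (hF.continuous.comp_continuousOn (hx u).continuousOn)).sub
          (hA.clm_apply ((hx v).continuousOn.sub (hx u).continuousOn)))).intervalIntegrable_of_Icc hT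
    have hdual := adjoint_apply_sub_eq_integral hT (hx u) (hx v) hA hp
    rw [intervalIntegral.integral_add hI1 hI2] at hdual
    have hDv : D (v - u) = ∫ t in (0 : ℝ)..T, p t (B (v t - u t)) := by
      rw [hD]
      refine intervalIntegral.integral_congr_ae ?_
      filter_upwards [ae_restrict_uIoc_of_ae_restrict_Icc hT hae] with t ht htm
      rw [ht htm]
    rw [← map_sub, hdual, hDv, add_sub_cancel_left]
    have := intervalIntegral.norm_integral_le_of_norm_le_const (a := 0) (b := T)
      (f := fun t => p t (F (x v t) - F (x u t) - fderiv ℝ F (x u t) (x v t - x u t)))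
      (C := P * (C * (G * ‖v - u‖) ^ 2)) (fun t htm => by
        have ht : t ∈ Icc 0 T := by
          rw [uIoc_of_le hT] at htm; exact Ioc_subset_Icc_self htm
        refine ((p t).le_of_opNorm_le (hP t ht) _).trans ?_
        gcongr
        refine (hC _ (mem_closedBall_zero_iff.2 (huR t ht)) _
          (mem_closedBall_zero_iff.2 (hvR t ht))).trans ?_
        gcongr
        exact hest t ht)
    rw [sub_zero, abs_of_nonneg hT] at this
    refine this.trans (le_of_eq ?_)
    ring
  refine .of_isLittleO ?_
  refine Asymptotics.IsBigO.trans_isLittleO (g := fun v => ‖v - u‖ ^ 2) ?_ ?_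
  · refine Asymptotics.IsBigO.of_bound (P * (C * G ^ 2) * T) ?_
    filter_upwards [Metric.closedBall_mem_nhds u one_pos] with v hv
    rw [norm_pow, norm_norm]
    exact key v (by simpa [dist_eq_norm] using hv)
  · exact (Asymptotics.isLittleO_pow_sub_sub u one_lt_two)

/-- If the adjoint equation along any curve can be observed through the input map, then the
end-point map is a submersion, so that its rank is constant. -/
theorem isOfConstantRank_of_observable {F : X → X} (hF : ContDiff ℝ 2 F) {B : U →L[ℝ] X}
    (hAB : HasAprioriBounds F B)
    (hobs : ∀ T : ℝ, 0 < T → ∀ x : ℝ → X, ContinuousOn x (Icc 0 T) → ∀ p : ℝ → X →L[ℝ] ℝ,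
      (∀ t ∈ Icc 0 T, HasDerivWithinAt p (-(p t).comp (fderiv ℝ F (x t))) (Icc 0 T) t) →
      (∀ t ∈ Icc 0 T, ∀ w, p t (B w) = 0) → p T = 0) :
    IsOfConstantRank (fun x w => F x + B w) := by
  intro x₀ T hT
  have hF1 : ContDiff ℝ 1 F := hF.of_le one_le_two
  have hTT : T ∈ Icc 0 T := ⟨hT.le, le_rfl⟩
  have hbd : ∀ v : ControlSpace U T, IsBoundedInput v T ‖v‖ := ControlSpace.isBoundedInput hT.le
  choose x hx using fun v : ControlSpace U T =>
    exists_isTrajectory hF1 hAB hT.le (norm_nonneg v) x₀ (hbd v)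
  have hA : ∀ u, ContinuousOn (fun t => fderiv ℝ F (x u t)) (Icc 0 T) := fun u =>
    (hF.continuous_fderiv two_ne_zero).comp_continuousOn (hx u).continuousOn
  choose p hpT hp using fun (u : ControlSpace U T) (l : X →L[ℝ] ℝ) =>
    exists_adjoint_solution hT.le (hA u) l
  have hpc : ∀ u l, ContinuousOn (fun t => (p u l t).comp B) (Icc 0 T) := fun u l =>
    ContinuousOn.clm_comp (fun t ht => (hp u l t ht).continuousWithinAt) continuousOn_const
  choose D hD using fun u l => exists_clm_eq_integral hT.le (hpc u l)
  have hlD : ∀ u l, HasFDerivAt (fun v => l (x v T)) (D u l) u := fun u l => by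
    have := hasFDerivAt_comp_endpoint hF hAB hT.le hx (hp u l) (hD u l)
    rwa [hpT u l] at this
  have hdiff : Differentiable ℝ (fun v => x v T) := fun u => by
    set e := (Module.finBasis ℝ X).equivFunL with he
    rw [← e.comp_differentiableAt_iff, differentiableAt_pi]
    exact fun i =>
      (hlD u ((ContinuousLinearMap.proj i).comp e.toContinuousLinearMap)).differentiableAt
  have hsurj : ∀ u, Function.Surjective (fderiv ℝ (fun v => x v T) u) := fun u => by
    by_contra hns
    have hlt : LinearMap.range (fderiv ℝ (fun v => x v T) u).toLinearMap < ⊤ :=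
      lt_top_iff_ne_top.2 fun h => hns (LinearMap.range_eq_top.1 h)
    obtain ⟨l₀, hl₀, hker⟩ := Submodule.exists_le_ker_of_lt_top _ hlt
    set l : X →L[ℝ] ℝ := LinearMap.toContinuousLinearMap l₀ with hl
    have hzero : ∀ h, D u l h = 0 := fun h => by
      have h1 : D u l = l.comp (fderiv ℝ (fun v => x v T) u) :=
        (hlD u l).unique (l.hasFDerivAt.comp u (hdiff u).hasFDerivAt)
      rw [h1]
      exact hker (LinearMap.mem_range_self _ h)
    have hpB : ∀ t ∈ Icc 0 T, ∀ w, p u l t (B w) = 0 := fun t ht w => by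
      -- The control `p(t)(B w) w` makes the pairing a square.
      have hcq : ContinuousOn (fun s => p u l s (B w)) (Icc 0 T) :=
        (hpc u l).clm_apply continuousOn_const
      have hc : ContinuousOn (fun s => p u l s (B w) • w) (Icc 0 T) := hcq.smul continuousOn_const
      obtain ⟨c, hcb⟩ := isCompact_Icc.exists_bound_of_continuousOn hc
      have hmem : MemLp (fun s => p u l s (B w) • w) ⊤ (volume.restrict (Icc 0 T)) :=
        memLp_top_of_bound (hc.aestronglyMeasurable_of_isCompact isCompact_Icc measurableSet_Icc) c
          ((ae_restrict_mem measurableSet_Icc).mono hcb)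
      have h1 := hzero (hmem.toLp _)
      rw [hD] at h1
      have h2 : ∫ s in (0 : ℝ)..T, (p u l s (B w)) ^ 2 = 0 := by
        refine Eq.trans (intervalIntegral.integral_congr_ae ?_) h1
        filter_upwards [ae_restrict_uIoc_of_ae_restrict_Icc hT.le
          (MemLp.coeFn_toLp hmem)] with s hs hsm
        rw [hs hsm, ContinuousLinearMap.comp_apply, map_smul, map_smul, smul_eq_mul, sq]
      by_contra hne
      exact (intervalIntegral.integral_pos hT (hcq.pow 2) (fun _ _ => sq_nonneg _)
        ⟨t, ht, (sq_nonneg _).lt_of_ne' (pow_ne_zero 2 hne)⟩).ne' h2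
    have hl0 := hobs T hT (x u) (hx u).continuousOn (p u l) (hp u l) hpB
    rw [hpT] at hl0
    exact hl₀ (LinearMap.ext fun y => by simpa [hl] using DFunLike.congr_fun hl0 y)
  refine ⟨fun v => x v T, fun u y => ⟨?_, fun h => ⟨x u, hx u, h.symm⟩⟩, hdiff, fun u₁ u₂ => ?_⟩
  · rintro ⟨z, hz, rfl⟩
    exact eqOn_of_isTrajectory hF1 hAB (hbd u) hz (hx u) hTT
  · rw [LinearMap.rank, LinearMap.rank, LinearMap.range_eq_top.2 (hsurj u₁),
      LinearMap.range_eq_top.2 (hsurj u₂)]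

end EndpointMap

/-! ### The multiparticle system -/

/-- The unforced part of the multiparticle system. -/
noncomputable def chainField (n : ℕ) (φ : ℝ → ℝ) (x : (Fin n → ℝ) × (Fin n → ℝ)) :
    (Fin n → ℝ) × (Fin n → ℝ) :=
  (x.2, fun k => interactionForce φ x.1 k)

/-- The input map of the double-forced system: the two forces act on the momenta of the first and
of the last particle. -/
noncomputable def endForcing (n : ℕ) : ℝ × ℝ →L[ℝ] (Fin n → ℝ) × (Fin n → ℝ) :=
  ContinuousLinearMap.prod 0 (ContinuousLinearMap.pi fun k =>
    (if (k : ℕ) = 0 then ContinuousLinearMap.fst ℝ ℝ ℝ else 0) +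
      (if (k : ℕ) + 1 = n then ContinuousLinearMap.snd ℝ ℝ ℝ else 0))

lemma endForcing_snd_apply (n : ℕ) (w : ℝ × ℝ) (k : Fin n) :
    (endForcing n w).2 k =
      (if (k : ℕ) = 0 then w.1 else 0) + (if (k : ℕ) + 1 = n then w.2 else 0) := by
  simp only [endForcing, ContinuousLinearMap.prod_apply, ContinuousLinearMap.pi_apply,
    add_apply]
  split_ifs <;> simp

/-- The double-forced system is affine in the control. -/
lemma doubleForcedField_eq (n : ℕ) (Φ : ℝ → ℝ) :
    doubleForcedField n Φ = fun x w => chainField n (deriv Φ) x + endForcing n w := by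
  funext x w
  refine Prod.ext ?_ (funext fun k => ?_)
  · simp [doubleForcedField, chainField, endForcing]
  · simp only [doubleForcedField, chainField, Prod.snd_add, Pi.add_apply, endForcing_snd_apply]
    ring

lemma contDiff_chainField {n : ℕ} {φ : ℝ → ℝ} {r : WithTop ℕ∞} (hφ : ContDiff ℝ r φ) :
    ContDiff ℝ r (chainField n φ) := by
  refine contDiff_snd.prodMk (contDiff_pi.2 fun k => ?_)
  unfold interactionForce
  split_ifs <;> fun_prop

/-! ### The linearised chain -/

/-- The differential of the force on the `k`-th particle with respect to the positions. -/
noncomputable def interactionForceDeriv {n : ℕ} (φ : ℝ → ℝ) (q : Fin n → ℝ) (k : Fin n) :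
    (Fin n → ℝ) →L[ℝ] ℝ :=
  (if 0 < (k : ℕ) then
    deriv φ (q ⟨(k : ℕ) - 1, lt_of_le_of_lt (Nat.sub_le _ _) k.isLt⟩ - q k) •
      (ContinuousLinearMap.proj (R := ℝ) (φ := fun _ : Fin n => ℝ)
          ⟨(k : ℕ) - 1, lt_of_le_of_lt (Nat.sub_le _ _) k.isLt⟩ -
        ContinuousLinearMap.proj (R := ℝ) (φ := fun _ : Fin n => ℝ) k)
    else 0) -
  (if h : (k : ℕ) + 1 < n then
    deriv φ (q k - q ⟨(k : ℕ) + 1, h⟩) •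
      (ContinuousLinearMap.proj (R := ℝ) (φ := fun _ : Fin n => ℝ) k -
        ContinuousLinearMap.proj (R := ℝ) (φ := fun _ : Fin n => ℝ) ⟨(k : ℕ) + 1, h⟩)
    else 0)

lemma hasFDerivAt_interactionForce {n : ℕ} {φ : ℝ → ℝ} (hφ : Differentiable ℝ φ)
    (q : Fin n → ℝ) (k : Fin n) :
    HasFDerivAt (fun q => interactionForce φ q k) (interactionForceDeriv φ q k) q := by
  have h : ∀ i j : Fin n, HasFDerivAt (fun q : Fin n → ℝ => φ (q i - q j))
      (deriv φ (q i - q j) • (ContinuousLinearMap.proj (R := ℝ) (φ := fun _ : Fin n => ℝ) i -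
        ContinuousLinearMap.proj (R := ℝ) (φ := fun _ : Fin n => ℝ) j)) q := fun i j =>
    (hφ _).hasDerivAt.comp_hasFDerivAt q ((hasFDerivAt_apply i q).sub (hasFDerivAt_apply j q))
  unfold interactionForce interactionForceDeriv
  refine HasFDerivAt.sub ?_ ?_
  · split_ifs
    · exact h _ _
    · exact hasFDerivAt_const _ _
  · split_ifs
    · exact h _ _
    · exact hasFDerivAt_const _ _

lemma fderiv_chainField_apply {n : ℕ} {φ : ℝ → ℝ} (hφ : Differentiable ℝ φ)
    (x v : (Fin n → ℝ) × (Fin n → ℝ)) :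
    fderiv ℝ (chainField n φ) x v = (v.2, fun k => interactionForceDeriv φ x.1 k v.1) := by
  have h : HasFDerivAt (chainField n φ) ((ContinuousLinearMap.snd ℝ _ _).prod
      (ContinuousLinearMap.pi fun k => (interactionForceDeriv φ x.1 k).comp
        (ContinuousLinearMap.fst ℝ (Fin n → ℝ) (Fin n → ℝ)))) x :=
    hasFDerivAt_snd.prodMk (hasFDerivAt_pi.2 fun k =>
      HasFDerivAt.comp x (hasFDerivAt_interactionForce hφ x.1 k) hasFDerivAt_fst)
  rw [h.fderiv]
  rfl

/-- A displacement of the `k`-th particle acts on its right neighbour through the stiffness of the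
link between them. -/
lemma interactionForceDeriv_single_succ {n : ℕ} (φ : ℝ → ℝ) (q : Fin n → ℝ) {k j : Fin n}
    (hkj : (j : ℕ) = k + 1) :
    interactionForceDeriv φ q j (Pi.single k 1) = deriv φ (q k - q j) := by
  have hk : (⟨(j : ℕ) - 1, lt_of_le_of_lt (Nat.sub_le _ _) j.isLt⟩ : Fin n) = k := by
    ext; simp [hkj]
  have hne : j ≠ k := fun h => by rw [h] at hkj; omega
  have hne' : ∀ h : (j : ℕ) + 1 < n, (⟨(j : ℕ) + 1, h⟩ : Fin n) ≠ k := fun h e => by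
    have := congrArg Fin.val e
    simp only at this
    omega
  have hpos : 0 < (j : ℕ) := by omega
  unfold interactionForceDeriv
  rw [hk, if_pos hpos]
  split_ifs with h <;> simp [hne, hne']

/-- A displacement of the `k`-th particle does not act beyond its right neighbour. -/
lemma interactionForceDeriv_single_of_lt {n : ℕ} (φ : ℝ → ℝ) (q : Fin n → ℝ) {k j : Fin n}
    (hkj : (k : ℕ) + 1 < j) : interactionForceDeriv φ q j (Pi.single k 1) = 0 := by
  have h1 : (⟨(j : ℕ) - 1, lt_of_le_of_lt (Nat.sub_le _ _) j.isLt⟩ : Fin n) ≠ k := fun e => by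
    have := congrArg Fin.val e
    simp only at this
    omega
  have hne : j ≠ k := fun h => by rw [h] at hkj; omega
  have hne' : ∀ h : (j : ℕ) + 1 < n, (⟨(j : ℕ) + 1, h⟩ : Fin n) ≠ k := fun h e => by
    have := congrArg Fin.val e
    simp only at this
    omega
  unfold interactionForceDeriv
  split_ifs with h h' <;> simp [hne, hne', h1]

/-- If a solution of the adjoint equation annihilates a fixed vector at all times, then it also
annihilates the image of that vector under the coefficient operators. -/
lemma adjoint_apply_apply_eq_zero {X : Type*} [NormedAddCommGroup X] [NormedSpace ℝ X] {T : ℝ}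
    (hT : 0 < T) {A : ℝ → X →L[ℝ] X} {p : ℝ → X →L[ℝ] ℝ}
    (hp : ∀ t ∈ Icc 0 T, HasDerivWithinAt p (-(p t).comp (A t)) (Icc 0 T) t) {v : X}
    (hv : ∀ t ∈ Icc 0 T, p t v = 0) : ∀ t ∈ Icc 0 T, p t (A t v) = 0 := fun t ht => by
  have h1 := (hp t ht).clm_apply (hasDerivWithinAt_const t (Icc 0 T) v)
  have h2 : HasDerivWithinAt (fun t => p t v) 0 (Icc 0 T) t :=
    (hasDerivWithinAt_const t (Icc 0 T) (0 : ℝ)).congr_of_mem hv ht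
  have h3 := (uniqueDiffOn_Icc hT t ht).eq_deriv _ h1 h2
  simpa using h3

/-- Observability of the adjoint chain from the momentum of the first particle alone: the
components of the adjoint state vanish one particle after the other, since no link has zero
stiffness. -/
theorem adjoint_chain_eq_zero {n : ℕ} {φ : ℝ → ℝ} (hφ : Differentiable ℝ φ)
    (hφ' : ∀ y, deriv φ y ≠ 0) {T : ℝ} (hT : 0 < T) {x : ℝ → (Fin n → ℝ) × (Fin n → ℝ)}
    {p : ℝ → (Fin n → ℝ) × (Fin n → ℝ) →L[ℝ] ℝ}
    (hp : ∀ t ∈ Icc 0 T,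
      HasDerivWithinAt p (-(p t).comp (fderiv ℝ (chainField n φ) (x t))) (Icc 0 T) t)
    (hpB : ∀ t ∈ Icc 0 T, ∀ w, p t (endForcing n w) = 0) : ∀ t ∈ Icc 0 T, p t = 0 := by
  -- The momentum components are differentiated into the position components.
  have hpos : ∀ k : Fin n, (∀ t ∈ Icc 0 T, p t (0, Pi.single k 1) = 0) →
      ∀ t ∈ Icc 0 T, p t (Pi.single k 1, 0) = 0 := fun k hk t ht => by
    have h := adjoint_apply_apply_eq_zero hT hp hk t ht
    rw [fderiv_chainField_apply hφ] at h
    simpa using! h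
  have hsum : ∀ t, ∀ w : Fin n → ℝ, p t (0, w) = ∑ j, w j * p t (0, Pi.single j 1) := fun t w => by
    have h : ((0, w) : (Fin n → ℝ) × (Fin n → ℝ)) = ∑ j, w j • (0, Pi.single j 1) := by
      refine Prod.ext ?_ (funext fun i => ?_)
      · simp [Prod.fst_sum]
      · simp [Prod.snd_sum, Finset.sum_apply, Pi.single_apply]
    rw [h, map_sum]
    simp only [map_smul, smul_eq_mul]
  have hsum' : ∀ t, ∀ w : Fin n → ℝ, p t (w, 0) = ∑ j, w j * p t (Pi.single j 1, 0) := fun t w => by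
    have h : ((w, 0) : (Fin n → ℝ) × (Fin n → ℝ)) = ∑ j, w j • (Pi.single j 1, 0) := by
      refine Prod.ext (funext fun i => ?_) ?_
      · simp [Prod.fst_sum, Finset.sum_apply, Pi.single_apply]
      · simp [Prod.snd_sum]
    rw [h, map_sum]
    simp only [map_smul, smul_eq_mul]
  have hmom : ∀ m : ℕ, ∀ k : Fin n, (k : ℕ) ≤ m → ∀ t ∈ Icc 0 T, p t (0, Pi.single k 1) = 0 := by
    intro m
    induction m with
    | zero =>
      intro k hk t ht
      have h : endForcing n (1, 0) = (0, Pi.single k 1) := by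
        refine Prod.ext (by simp [endForcing]) (funext fun j => ?_)
        rw [endForcing_snd_apply]
        simp only [Pi.single_apply, Fin.ext_iff, Nat.le_zero.1 hk]
        simp
      rw [← h]
      exact hpB t ht _
    | succ m ih =>
      intro j hj t ht
      rcases Nat.lt_or_ge (j : ℕ) (m + 1) with hlt | hge
      · exact ih j (by omega) t ht
      · have hjm : (j : ℕ) = m + 1 := le_antisymm hj hge
        set k : Fin n := ⟨m, by omega⟩ with hk
        have h := adjoint_apply_apply_eq_zero hT hp (hpos k (ih k le_rfl)) t ht
        -- Only the right neighbour contributes: the particles up to `k` do so with vanishing adjoint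
        -- components, and those further to the right do not interact with `k`.
        rw [fderiv_chainField_apply hφ, hsum, Finset.sum_eq_single j] at h
        · rw [interactionForceDeriv_single_succ φ _ (k := k) hjm] at h
          exact (mul_eq_zero.1 h).resolve_left (hφ' _)
        · intro i _ hij
          rcases Nat.lt_or_ge (i : ℕ) (m + 1) with hi | hi
          · rw [ih i (by omega) t ht, mul_zero]
          · have : (k : ℕ) + 1 < i := by
              have : (i : ℕ) ≠ j := fun e => hij (Fin.ext e)
              simp only [hk]
              omega
            rw [interactionForceDeriv_single_of_lt φ _ this, zero_mul]
        · simp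
  intro t ht
  have hm : ∀ k : Fin n, ∀ t ∈ Icc 0 T, p t (0, Pi.single k 1) = 0 := fun k => hmom k k le_rfl
  refine ContinuousLinearMap.ext fun ⟨v, w⟩ => ?_
  have hvw : ((v, w) : (Fin n → ℝ) × (Fin n → ℝ)) = (v, 0) + (0, w) := by simp
  rw [hvw, map_add, hsum, hsum']
  simp [hm _ t ht, hpos _ (hm _) t ht]

/-! ### Energy estimates -/

/-- The virtual work of the interaction forces. -/
lemma sum_mul_interactionForce {m : ℕ} (φ : ℝ → ℝ) (q p : Fin (m + 1) → ℝ) :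
    ∑ k, p k * interactionForce φ q k =
      -∑ i : Fin m, φ (q i.castSucc - q i.succ) * (p i.castSucc - p i.succ) := by
  have h1 : ∑ k : Fin (m + 1), p k * (if 0 < (k : ℕ) then
      φ (q ⟨(k : ℕ) - 1, lt_of_le_of_lt (Nat.sub_le _ _) k.isLt⟩ - q k) else 0) =
      ∑ i : Fin m, p i.succ * φ (q i.castSucc - q i.succ) := by
    rw [Fin.sum_univ_succ]
    simp
    rfl
  have h2 : ∑ k : Fin (m + 1), p k * (if h : (k : ℕ) + 1 < m + 1 then
      φ (q k - q ⟨(k : ℕ) + 1, h⟩) else 0) =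
      ∑ i : Fin m, p i.castSucc * φ (q i.castSucc - q i.succ) := by
    rw [Fin.sum_univ_castSucc]
    simp
    rfl
  simp only [interactionForce, mul_sub, Finset.sum_sub_distrib, h1, h2]
  simp only [mul_comm (p _)]
  ring

/-- The total energy of the chain of `m + 1` particles, whose `m` links join `i.castSucc` to
`i.succ`. -/
noncomputable def chainEnergy {m : ℕ} (Φ : ℝ → ℝ)
    (x : (Fin (m + 1) → ℝ) × (Fin (m + 1) → ℝ)) : ℝ :=
  ∑ k, x.2 k ^ 2 / 2 + ∑ i : Fin m, Φ (x.1 i.castSucc - x.1 i.succ)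

lemma contDiff_chainEnergy {m : ℕ} {Φ : ℝ → ℝ} (hΦ : ContDiff ℝ 1 Φ) :
    ContDiff ℝ 1 (chainEnergy (m := m) Φ) := by
  unfold chainEnergy
  refine ContDiff.add (ContDiff.sum fun k _ => by fun_prop) (ContDiff.sum fun i _ => by fun_prop)

/-- Along the forced chain only the power of the two external forces changes the energy. -/
lemma fderiv_chainEnergy_apply {m : ℕ} {Φ : ℝ → ℝ} (hΦ : ContDiff ℝ 1 Φ)
    (x : (Fin (m + 1) → ℝ) × (Fin (m + 1) → ℝ)) (w : ℝ × ℝ) :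
    fderiv ℝ (chainEnergy Φ) x (chainField (m + 1) (deriv Φ) x + endForcing (m + 1) w) =
      x.2 0 * w.1 + x.2 (Fin.last m) * w.2 := by
  set v := chainField (m + 1) (deriv Φ) x + endForcing (m + 1) w with hv
  -- The differential is computed as a derivative along the line through `x` with direction `v`.
  have hline : HasDerivAt (fun s : ℝ => x + s • v) v 0 := by
    simpa using! ((hasDerivAt_id (0 : ℝ)).smul_const v).const_add x
  have h1 : HasDerivAt (fun s : ℝ => chainEnergy Φ (x + s • v))
      (fderiv ℝ (chainEnergy Φ) x v) 0 := by
    have := ((contDiff_chainEnergy hΦ).differentiable one_ne_zero (x + (0 : ℝ) • v)).hasFDerivAt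
    simpa using! this.comp_hasDerivAt (0 : ℝ) hline
  have h2 : HasDerivAt (fun s : ℝ => chainEnergy Φ (x + s • v))
      (∑ k, x.2 k * v.2 k +
        ∑ i : Fin m, deriv Φ (x.1 i.castSucc - x.1 i.succ) * (v.1 i.castSucc - v.1 i.succ)) 0 := by
    refine HasDerivAt.add (HasDerivAt.fun_sum fun k _ => ?_) (HasDerivAt.fun_sum fun i _ => ?_)
    · have hk : HasDerivAt (fun s : ℝ => x.2 k + s * v.2 k) (v.2 k) 0 := by
        simpa using! ((hasDerivAt_id (0 : ℝ)).mul_const (v.2 k)).const_add (x.2 k)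
      refine ((hk.pow 2).div_const 2).congr_deriv ?_
      simp
      ring
    · have hk : HasDerivAt (fun s : ℝ => (x.1 i.castSucc + s * v.1 i.castSucc) -
          (x.1 i.succ + s * v.1 i.succ)) (v.1 i.castSucc - v.1 i.succ) 0 := by
        simpa using! (((hasDerivAt_id (0 : ℝ)).mul_const (v.1 i.castSucc)).const_add
          (x.1 i.castSucc)).sub (((hasDerivAt_id (0 : ℝ)).mul_const (v.1 i.succ)).const_add
          (x.1 i.succ))
      have hc := ((hΦ.differentiable one_ne_zero) ((x.1 i.castSucc + 0 * v.1 i.castSucc) -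
          (x.1 i.succ + 0 * v.1 i.succ))).hasDerivAt.comp (0 : ℝ) hk
      simpa using! hc
  rw [h1.unique h2]
  have hv1 : v.1 = x.2 := by simp [hv, chainField, endForcing]
  have hv2 : ∀ k, v.2 k = interactionForce (deriv Φ) x.1 k + (endForcing (m + 1) w).2 k :=
    fun k => rfl
  simp only [hv1, hv2, mul_add, Finset.sum_add_distrib, sum_mul_interactionForce]
  have h3 : ∑ k, x.2 k * (endForcing (m + 1) w).2 k = x.2 0 * w.1 + x.2 (Fin.last m) * w.2 := by
    simp only [endForcing_snd_apply, mul_add, Finset.sum_add_distrib]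
    congr 1
    · rw [Finset.sum_eq_single 0]
      · simp
      · intro k _ hk
        have : (k : ℕ) ≠ 0 := fun e => hk (Fin.ext e)
        simp [this]
      · simp
    · rw [Finset.sum_eq_single (Fin.last m)]
      · simp
      · intro k _ hk
        have : (k : ℕ) ≠ m := fun e => hk (Fin.ext e)
        simp [this]
      · simp
  rw [h3]
  ring

lemma norm_sq_le_sum_sq {ι : Type*} [Fintype ι] (p : ι → ℝ) : ‖p‖ ^ 2 ≤ ∑ k, p k ^ 2 := by
  have h0 : 0 ≤ ∑ k, p k ^ 2 := Finset.sum_nonneg fun k _ => sq_nonneg _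
  have h : ‖p‖ ≤ √(∑ k, p k ^ 2) := (pi_norm_le_iff_of_nonneg (Real.sqrt_nonneg _)).2 fun k => by
    rw [Real.norm_eq_abs]
    exact Real.abs_le_sqrt (Finset.single_le_sum (f := fun k => p k ^ 2)
      (fun k _ => sq_nonneg _) (Finset.mem_univ k))
  calc ‖p‖ ^ 2 ≤ √(∑ k, p k ^ 2) ^ 2 := by gcongr
    _ = _ := Real.sq_sqrt h0

/-- The energy controls the momenta, since the potential is bounded below, and its growth is at most
linear in the largest momentum; hence the momenta, and then the positions, stay bounded. -/
theorem hasAprioriBounds_chain {n : ℕ} (hn : n ≠ 0) {Φ : ℝ → ℝ} (hΦ : ContDiff ℝ 1 Φ)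
    (hbdd : BddBelow (Set.range Φ)) :
    HasAprioriBounds (chainField n (deriv Φ)) (endForcing n) := by
  obtain ⟨m, rfl⟩ := Nat.exists_eq_succ_of_ne_zero hn
  obtain ⟨c, hc⟩ := hbdd
  have hcΦ : ∀ y, c ≤ Φ y := fun y => hc (Set.mem_range_self y)
  intro x₀ T M
  set N := max M 0 with hN
  have hN0 : 0 ≤ N := le_max_right _ _
  set C := 2 * |chainEnergy Φ x₀ - m * c| with hC
  have hC0 : 0 ≤ C := by positivity
  set S := C + 1 + 4 * (|T| * N) with hS
  have hS0 : 0 ≤ S := by positivity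
  refine ⟨S + ‖x₀‖ + |T| * S, fun τ hτ u hu x hx => ?_⟩
  have hTabs : |T| = T := abs_of_nonneg (hτ.1.trans hτ.2)
  replace hu : IsBoundedInput u τ N := hu.weaken (le_max_left _ _)
  have hkin : ∀ y : (Fin (m + 1) → ℝ) × (Fin (m + 1) → ℝ),
      ‖y.2‖ ^ 2 / 2 + m * c ≤ chainEnergy Φ y := fun y => by
    unfold chainEnergy
    gcongr
    · rw [← Finset.sum_div]
      gcongr
      exact norm_sq_le_sum_sq _
    · calc (m : ℝ) * c = ∑ i : Fin m, c := by simp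
        _ ≤ _ := Finset.sum_le_sum fun i _ => hcΦ _
  -- The time at which the largest momentum occurs.
  obtain ⟨s, hs, hmax⟩ := isCompact_Icc.exists_isMaxOn (nonempty_Icc.2 hτ.1)
    (hx.continuousOn.snd.norm)
  have hmax' : ∀ t ∈ Icc 0 τ, ‖(x t).2‖ ≤ ‖(x s).2‖ := fun t ht => hmax ht
  set P := ‖(x s).2‖ with hP
  have hP0 : 0 ≤ P := norm_nonneg _
  have hen := sub_eq_integral_fderiv_of_eq_integral (contDiff_chainEnergy (m := m) hΦ) hs.1
    (hx.mono hs).integrable (hx.mono hs).continuousOn (fun t ht => by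
      rw [hx.apply_zero hτ.1]
      exact (hx.mono hs).eq_integral t ht)
  simp only [fderiv_chainEnergy_apply hΦ] at hen
  have hwork := intervalIntegral.norm_integral_le_of_norm_le_const_ae (a := 0) (b := s)
    (f := fun t => (x t).2 0 * (u t).1 + (x t).2 (Fin.last m) * (u t).2) (C := 2 * P * N) (by
      filter_upwards [ae_restrict_uIoc_of_ae_restrict_Icc hs.1 (hu.mono hs).2] with t ht htm
      have htI : t ∈ Icc 0 τ := by
        rw [uIoc_of_le hs.1] at htm
        exact ⟨htm.1.le, htm.2.trans hs.2⟩
      have hut := ht htm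
      have h0 : ‖(x t).2 0‖ ≤ P := (norm_le_pi_norm _ _).trans (hmax' t htI)
      have h1 : ‖(x t).2 (Fin.last m)‖ ≤ P := (norm_le_pi_norm _ _).trans (hmax' t htI)
      have h2 : ‖(u t).1‖ ≤ N := (norm_fst_le _).trans hut
      have h3 : ‖(u t).2‖ ≤ N := (norm_snd_le _).trans hut
      calc ‖(x t).2 0 * (u t).1 + (x t).2 (Fin.last m) * (u t).2‖
          ≤ ‖(x t).2 0‖ * ‖(u t).1‖ + ‖(x t).2 (Fin.last m)‖ * ‖(u t).2‖ := by
            rw [← norm_mul, ← norm_mul]; exact norm_add_le _ _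
        _ ≤ P * N + P * N := by gcongr
        _ = 2 * P * N := by ring)
  rw [← hen, sub_zero, abs_of_nonneg hs.1, hx.apply_zero hτ.1, Real.norm_eq_abs] at hwork
  -- The energy balance reads `P ^ 2 ≤ C + 4 * (|T| * N) * P`, and `S` is chosen so that this fails
  -- for `P > S`.
  have hPS : P ≤ S := by
    have h1 := (le_abs_self _).trans hwork
    have h2 := hkin (x s)
    have h3 : 2 * P * N * s ≤ 2 * P * N * |T| := by
      gcongr
      rw [hTabs]; exact hs.2.trans hτ.2
    have h4 := le_abs_self (chainEnergy Φ x₀ - m * c)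
    have h5 : P ^ 2 ≤ C + 4 * (|T| * N) * P := by
      rw [hC]; linarith
    by_contra! hlt
    have hTN : 0 ≤ |T| * N := by positivity
    have hP1 : 1 ≤ P := by linarith
    have h6 : S * P ≤ P ^ 2 := by rw [sq]; gcongr
    have h7 : C * 1 ≤ C * P := by gcongr
    rw [hS] at h6
    linarith
  intro t ht
  have hp : ‖(x t).2‖ ≤ S := (hmax' t ht).trans hPS
  have hq : ‖(x t).1‖ ≤ ‖x₀‖ + |T| * S := by
    have h1 : (x t).1 = x₀.1 + ∫ s in (0 : ℝ)..t, (x s).2 := by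
      have h2 := congrArg Prod.fst (hx.eq_integral t ht)
      have h3 := (ContinuousLinearMap.fst ℝ (Fin (m + 1) → ℝ)
        (Fin (m + 1) → ℝ)).intervalIntegral_comp_comm (hx.mono ht).integrable
      rw [h2, Prod.fst_add]
      congr 1
      refine h3.symm.trans (intervalIntegral.integral_congr fun s _ => ?_)
      simp [chainField, endForcing]
    have h4 := intervalIntegral.norm_integral_le_of_norm_le_const (a := 0) (b := t)
      (f := fun s => (x s).2) (C := S) (fun s hsm => by
        rw [uIoc_of_le ht.1] at hsm
        exact (hmax' s ⟨hsm.1.le, hsm.2.trans ht.2⟩).trans hPS)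
    rw [sub_zero, abs_of_nonneg ht.1, mul_comm] at h4
    rw [h1]
    refine (norm_add_le _ _).trans (add_le_add (norm_fst_le _) (h4.trans ?_))
    gcongr
    rw [hTabs]; exact ht.2.trans hτ.2
  have hTS : 0 ≤ |T| * S := by positivity
  have hx0 := norm_nonneg x₀
  exact norm_prod_le_iff.2 ⟨by linarith, by linarith⟩

theorem mainTheorem9 (n : ℕ) (hn : 2 ≤ n) (Φ : ℝ → ℝ)
    (hΦ_analytic : ∀ y : ℝ, AnalyticAt ℝ Φ y)
    (hΦ_bddBelow : BddBelow (Set.range Φ))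
    (hΦ_growth : Filter.Tendsto Φ Filter.atTop Filter.atTop)
    (hφ' : ∀ y : ℝ, deriv (deriv Φ) y ≠ 0) :
    IsOfConstantRank (doubleForcedField n Φ) := by
  have hΦ : ContDiff ℝ 1 Φ := contDiff_iff_contDiffAt.2 fun y => (hΦ_analytic y).contDiffAt
  have hφ : ContDiff ℝ 2 (deriv Φ) :=
    contDiff_iff_contDiffAt.2 fun y => (hΦ_analytic y).deriv.contDiffAt
  rw [doubleForcedField_eq]
  exact isOfConstantRank_of_observable (contDiff_chainField hφ)
    (hasAprioriBounds_chain (by omega) hΦ hΦ_bddBelow)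
    fun T hT x _ p hp hpB => adjoint_chain_eq_zero (hφ.differentiable two_ne_zero) hφ' hT hp
      hpB T ⟨hT.le, le_rfl⟩
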